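/- **Theorem.** Every $(4,6)$-fullerene (boron-nitrogen fullerene) $G$ has anti-Kekulé number $ak(G)=4$. Here all graphs are finite and simple. A $(4,6)$-fullerene is a $3$-connected cubic planar graph that has an embedding in the plane all of whose faces (including the outer one) are quadrangles or hexagons. (Embeddings are described combinatorially, by a rotation system, that is, a cyclic order of the edges at each vertex; the faces are the orbits of the face-tracing permutation on oriented edges, the length of a face is the number of oriented edges in its orbit, and planarity means $|V|-|E|+|F|=2$.) An anti-Kekulé set of $G$ is a set $S$ of edges of $G$ such that $G-S$, the spanning subgraph of $G$ obtained by deleting the edges in $S$, is connected and has no perfect matching. The anti-Kekulé number $ak(G)$ is the cardinality of a smallest anti-Kekulé set of $G$; in particular, the theorem says that $G$ has an anti-Kekulé set with $4$ elements and none with fewer. -/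

import Mathlib

namespace AntiKekule

/-- `S` is an anti-Kekulé set of `G`: a set of edges of `G` such that `G - S` is connected and
has no perfect matching. -/
def IsAntiKekuleSet {V : Type*} (G : SimpleGraph V) (S : Set (Sym2 V)) : Prop :=
  S ⊆ G.edgeSet ∧ (G.deleteEdges S).Connected ∧
    ¬ ∃ M : (G.deleteEdges S).Subgraph, M.IsPerfectMatching

/-- The anti-Kekulé number of `G`: the cardinality of a smallest anti-Kekulé set, which is `⊤` if
there is no anti-Kekulé set. In particular, for `n : ℕ`, it is equal to `n` exactly if some
anti-Kekulé set has `n` elements and none has fewer. -/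
noncomputable def antiKekuleNumber {V : Type*} (G : SimpleGraph V) : ℕ∞ :=
  ⨅ (S : Set (Sym2 V)) (_ : IsAntiKekuleSet G S), S.encard

/-- A finite graph is `k`-connected if it has more than `k` vertices and it remains connected
whenever fewer than `k` vertices are deleted. -/
def IsVertexConnected {V : Type*} (G : SimpleGraph V) (k : ℕ) : Prop :=
  k < Nat.card V ∧ ∀ S : Set V, S.ncard < k → (G.induce Sᶜ).Connected

/-- A rotation system on `G`: for every vertex, a cyclic order of the darts (oriented edges) that
leave this vertex. Rotation systems describe the cellular embeddings of a finite connected graph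
in closed oriented surfaces. -/
structure RotationSystem {V : Type*} (G : SimpleGraph V) where
  /-- The dart that follows a given dart in the cyclic order around its initial vertex. -/
  next : Equiv.Perm G.Dart
  next_fst : ∀ d : G.Dart, (next d).fst = d.fst
  next_sameCycle : ∀ d e : G.Dart, d.fst = e.fst → next.SameCycle d e

namespace RotationSystem

variable {V : Type*} {G : SimpleGraph V}

/-- The permutation that traces the faces: cross the edge of the dart `d`, then turn to the next
dart around the vertex reached. -/
def facePerm (R : RotationSystem G) : Equiv.Perm G.Dart :=
  (Function.Involutive.toPerm SimpleGraph.Dart.symm SimpleGraph.Dart.symm_involutive).trans R.next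

/-- The faces of the embedding: the orbits of the face-tracing permutation. -/
abbrev Face (R : RotationSystem G) : Type _ :=
  Quotient (Equiv.Perm.SameCycle.setoid R.facePerm)

/-- The length of a face, that is, of the closed walk that bounds it. A face of length `k` is a
`k`-gon. -/
noncomputable def Face.length {R : RotationSystem G} (f : R.Face) : ℕ :=
  {d : G.Dart | Quotient.mk (Equiv.Perm.SameCycle.setoid R.facePerm) d = f}.ncard

/-- The embedding of a finite connected graph with at least one edge given by `R` is an embedding
in the sphere (equivalently, in the plane): its Euler characteristic `|V| - |E| + |F|` is `2`. -/
def IsPlanar (R : RotationSystem G) : Prop :=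
  Nat.card V + Nat.card R.Face = Nat.card G.edgeSet + 2

end RotationSystem

/-- A `(k,6)`-cage: a 3-connected cubic planar graph all of whose faces are `k`-gons or
hexagons. -/
structure IsCage {V : Type*} [Fintype V] (k : ℕ) (G : SimpleGraph V) [DecidableRel G.Adj] :
    Prop where
  connected : IsVertexConnected G 3
  cubic : G.IsRegularOfDegree 3
  planar : ∃ R : RotationSystem G, R.IsPlanar ∧ ∀ f : R.Face, f.length = k ∨ f.length = 6

/-- A (4,6)-fullerene, or boron-nitrogen fullerene, is a `(4,6)`-cage. -/
def IsFullerene46 {V : Type*} [Fintype V] (G : SimpleGraph V) [DecidableRel G.Adj] : Prop :=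
  IsCage 4 G

end AntiKekule

/-!
The theorem needs two facts.

*Four edges suffice.* Let `b` be a vertex with two neighbours `w₁` and `w₂`. Deleting every edge at
`w₁` or `w₂` that does not contain `b` removes at most four edges of a cubic graph, and makes both
`w₁` and `w₂` pendant vertices attached to `b`, so that no perfect matching is left. What remains is
connected, since a 3-connected graph stays connected when `w₁` and `w₂` are removed
(`exists_isAntiKekuleSet_encard_le_four`).

*Three edges do not suffice.* All faces have even length, and this forces the graph `G` to be
bipartite (`isBipartite_of_isPlanar_of_even_length`): over the field with two elements, consider the
cochain complex of the embedding, from functions on vertices via functions on edges to functions on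
faces. As `G` and its dual are connected, the two coboundary maps have ranks `|V| - 1` and
`|F| - 1`, and Euler's formula says precisely that the complex is exact in the middle. The constant
function `1` on the edges is a cocycle because faces are even, so it is the coboundary of a function
on the vertices, which is a proper 2-colouring.

Now let `S` be a set of at most `k` edges of a `k`-regular bipartite graph `G` such that `G - S` is
connected, and suppose that Hall's condition fails in `G - S`: some set `A` inside one colour class
has a neighbourhood `N` with `|N| < |A|`. Counting the `k|A|` edges of `G` at `A` shows
`k|A| ≤ |S| + k|N| ≤ k + k(|A| - 1)`, so equality holds throughout and no edge of `G - S` joins `N` to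
a vertex outside `A`. Hence `A ∪ N` is closed under adjacency in `G - S`, so it is everything; this
contradicts the equality of the sizes of the two colour classes
(`exists_isPerfectMatching_deleteEdges`). For `k = 3` this is the lower bound.
-/

namespace AntiKekule

open SimpleGraph Finset

/-! ### Planar graphs with even faces are bipartite -/

section Bipartite

variable {V : Type*} {G : SimpleGraph V}

/-- A set of vertices of a connected graph that is closed under adjacency and nonempty contains
every vertex. -/
lemma forall_of_connected (hG : G.Connected) {P : V → Prop} {a : V} (ha : P a)
    (h : ∀ u v, G.Adj u v → P u → P v) (b : V) : P b := by
  obtain ⟨w⟩ := hG.preconnected a b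
  induction w with
  | nil => exact ha
  | cons hadj _ ih => exact ih (h _ _ hadj ha)

/-- A linear map from `ι → K` to a vector space whose kernel consists of constant functions has
rank at least `|ι| - 1`. -/
lemma card_le_finrank_range_add_one {K ι M : Type*} [Field K] [Fintype ι] [AddCommGroup M]
    [Module K M] (φ : (ι → K) →ₗ[K] M) (hφ : ∀ x, φ x = 0 → ∀ i j, x i = x j) :
    Fintype.card ι ≤ Module.finrank K (LinearMap.range φ) + 1 := by
  have hker : Module.finrank K (LinearMap.ker φ) ≤ 1 := by
    have hle : LinearMap.ker φ ≤ Submodule.span K {fun _ : ι => (1 : K)} := by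
      intro x hx
      rw [Submodule.mem_span_singleton]
      rcases isEmpty_or_nonempty ι with _ | ⟨⟨i⟩⟩
      · exact ⟨0, Subsingleton.elim _ _⟩
      · exact ⟨x i, funext fun j => by simpa using hφ x hx i j⟩
    refine (Submodule.finrank_mono hle).trans ?_
    exact (finrank_span_le_card _).trans (by simp)
  have := LinearMap.finrank_range_add_finrank_ker φ
  rw [Module.finrank_fintype_fun_eq_card] at this
  lia

/-- The underlying edge of a dart, as an element of the edge set. -/
def dartEdge (d : G.Dart) : G.edgeSet := ⟨d.edge, d.edge_mem⟩

/-- The coboundary of a function on the vertices, modulo 2: its value at an edge is the sum of the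
values at the two ends. -/
def vertexCoboundary (G : SimpleGraph V) : (V → ZMod 2) →ₗ[ZMod 2] (G.edgeSet → ZMod 2) where
  toFun x e := Sym2.lift ⟨fun u v => x u + x v, fun _ _ => add_comm _ _⟩ e.1
  map_add' x y := by
    ext ⟨e, he⟩
    induction e with | _ u v
    simp only [Sym2.lift_mk, Pi.add_apply]
    ring
  map_smul' c x := by
    ext ⟨e, he⟩
    induction e with | _ u v
    simp [mul_add]

lemma vertexCoboundary_dartEdge (x : V → ZMod 2) (d : G.Dart) :
    vertexCoboundary G x (dartEdge d) = x d.fst + x d.snd := rfl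

lemma exists_dartEdge_eq (e : G.edgeSet) : ∃ d : G.Dart, dartEdge d = e := by
  obtain ⟨e, he⟩ := e
  induction e with | _ u v
  exact ⟨⟨(u, v), he⟩, rfl⟩

lemma dartEdge_eq_iff {d d' : G.Dart} : dartEdge d = dartEdge d' ↔ d = d' ∨ d = d'.symm := by
  rw [← dart_edge_eq_iff, dartEdge, dartEdge, Subtype.mk.injEq]

variable (R : RotationSystem G)

/-- The face whose boundary walk traverses a given dart. -/
def faceOf (d : G.Dart) : R.Face := Quotient.mk (Equiv.Perm.SameCycle.setoid R.facePerm) d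

lemma faceOf_facePerm (d : G.Dart) : faceOf R (R.facePerm d) = faceOf R d :=
  Quotient.sound (s := Equiv.Perm.SameCycle.setoid R.facePerm)
    (Equiv.Perm.sameCycle_apply_left.2 (Equiv.Perm.SameCycle.refl _ _))

lemma facePerm_fst (d : G.Dart) : (R.facePerm d).fst = d.snd := R.next_fst d.symm

/-- The dual graph is connected: a function on the faces that takes the same value on both sides of
every edge is constant. -/
lemma eq_of_forall_faceOf_symm {α : Type*} (hG : G.Connected) (h : R.Face → α)
    (hh : ∀ d : G.Dart, h (faceOf R d) = h (faceOf R d.symm)) (f g : R.Face) : h f = h g := by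
  have hnext : ∀ d, h (faceOf R (R.next d)) = h (faceOf R d) := fun d => by
    have := faceOf_facePerm R d.symm
    rw [show R.facePerm d.symm = R.next d by simp [RotationSystem.facePerm]] at this
    rw [this, hh d]
  have hvert : ∀ d e : G.Dart, d.fst = e.fst → h (faceOf R d) = h (faceOf R e) := by
    intro d e hde
    obtain ⟨n, rfl⟩ := R.next_sameCycle d e hde
    induction n with
    | zero => rfl
    | succ n ih =>
      rw [add_comm, zpow_one_add, Equiv.Perm.mul_apply, hnext]
      exact ih (by
        rw [hde, add_comm, zpow_one_add, Equiv.Perm.mul_apply, R.next_fst])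
    | pred n ih =>
      have hs : (R.next ^ (-(n : ℤ))) d = R.next ((R.next ^ (-(n : ℤ) - 1)) d) := by
        rw [← Equiv.Perm.mul_apply, ← zpow_one_add]
        congr 2
        ring
      rw [← hnext ((R.next ^ (-(n : ℤ) - 1)) d), ← hs]
      exact ih (by rw [hde, hs, R.next_fst])
  induction f using Quotient.inductionOn with | _ d
  induction g using Quotient.inductionOn with | _ e
  refine forall_of_connected hG (P := fun v => ∀ e : G.Dart, e.fst = v →
    h (faceOf R d) = h (faceOf R e)) (a := d.fst) (fun e he => hvert d e he.symm) ?_ e.fst e rfl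
  intro u v huv hu e he
  rw [hu ⟨(u, v), huv⟩ rfl, hh]
  exact hvert _ _ he.symm

variable [Fintype V]

open Classical in
/-- The matrix, modulo 2, of the coboundary map from functions on the edges to functions on the
faces: the entry at a face and an edge counts how often the edge occurs on the boundary of the
face. -/
noncomputable def faceMatrix : Matrix R.Face G.edgeSet (ZMod 2) :=
  fun f e => ∑ d : G.Dart, if faceOf R d = f ∧ dartEdge d = e then 1 else 0

open Classical in
lemma faceMatrix_mulVec (g : G.edgeSet → ZMod 2) (f : R.Face) :
    (faceMatrix R).mulVec g f = ∑ d : G.Dart with faceOf R d = f, g (dartEdge d) := by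
  simp only [Matrix.mulVec, dotProduct, faceMatrix, sum_mul]
  rw [sum_comm, sum_filter]
  refine sum_congr rfl fun d _ => ?_
  by_cases hd : faceOf R d = f <;> simp [hd]

open Classical in
lemma faceMatrix_transpose_mulVec (h : R.Face → ZMod 2) (d : G.Dart) :
    (faceMatrix R).transpose.mulVec h (dartEdge d) = h (faceOf R d) + h (faceOf R d.symm) := by
  simp only [Matrix.mulVec, dotProduct, faceMatrix, sum_mul, Matrix.transpose_apply]
  rw [sum_comm, ← sum_pair (f := fun d' : G.Dart => h (faceOf R d')) d.symm_ne.symm]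
  rw [← sum_subset (subset_univ {d, d.symm})]
  · refine sum_congr rfl fun d' hd' => ?_
    have : dartEdge d' = dartEdge d := dartEdge_eq_iff.2 (by simpa using hd')
    simp [this]
  · intro d' _ hd'
    have : dartEdge d' ≠ dartEdge d := fun he => hd' (by simpa using dartEdge_eq_iff.1 he)
    simp [this]

open Classical in
/-- The composite of the two coboundary maps vanishes. -/
lemma faceMatrix_mulVec_vertexCoboundary (x : V → ZMod 2) :
    (faceMatrix R).mulVec (vertexCoboundary G x) = 0 := by
  funext f
  simp only [faceMatrix_mulVec, vertexCoboundary_dartEdge, sum_add_distrib, Pi.zero_apply]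
  -- Along the boundary of `f`, the end of a dart is the start of the next one.
  have : ∑ d : G.Dart with faceOf R d = f, x d.snd
      = ∑ d : G.Dart with faceOf R d = f, x d.fst :=
    sum_equiv R.facePerm (fun d => by simp [faceOf_facePerm])
      (fun d _ => by rw [facePerm_fst])
  rw [this, CharTwo.add_self_eq_zero]

open Classical in
/-- The constant function `1` on the edges is a cocycle if all faces have even length. -/
lemma faceMatrix_mulVec_one (hR : ∀ f : R.Face, Even f.length) :
    (faceMatrix R).mulVec 1 = 0 := by
  funext f
  rw [faceMatrix_mulVec]
  have h : f.length = #{d : G.Dart | faceOf R d = f} := by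
    rw [← Set.ncard_coe_finset]
    simp only [coe_filter, mem_univ, true_and]
    rfl
  simpa [← h] using (ZMod.natCast_eq_zero_iff_even).2 (hR f)

/-- A connected graph with an embedding in the sphere all of whose faces have even length is
bipartite. -/
theorem isBipartite_of_isPlanar_of_even_length (hG : G.Connected) (hp : R.IsPlanar)
    (hR : ∀ f : R.Face, Even f.length) : G.IsBipartite := by
  classical
  have hV := card_le_finrank_range_add_one (vertexCoboundary G) fun x hx u v => by
    refine forall_of_connected hG (P := fun v => x u = x v) rfl (fun a b hab ha => ?_) v
    have := congrFun hx (dartEdge ⟨(a, b), hab⟩)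
    rw [vertexCoboundary_dartEdge] at this
    exact ha.trans (CharTwo.add_eq_zero.1 this)
  have hF := card_le_finrank_range_add_one (faceMatrix R).transpose.mulVecLin fun h hh =>
    eq_of_forall_faceOf_symm R hG h fun d => by
      have := congrFun hh (dartEdge d)
      rw [Matrix.mulVecLin_apply, faceMatrix_transpose_mulVec] at this
      exact CharTwo.add_eq_zero.1 this
  have hrank : Module.finrank (ZMod 2) (LinearMap.range (faceMatrix R).transpose.mulVecLin)
      = Module.finrank (ZMod 2) (LinearMap.range (faceMatrix R).mulVecLin) :=
    (faceMatrix R).rank_transpose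
  have hE := LinearMap.finrank_range_add_finrank_ker (faceMatrix R).mulVecLin
  rw [Module.finrank_fintype_fun_eq_card] at hE
  rw [RotationSystem.IsPlanar, Nat.card_eq_fintype_card, Nat.card_eq_fintype_card,
    Nat.card_eq_fintype_card] at hp
  have hexact : LinearMap.range (vertexCoboundary G) = LinearMap.ker (faceMatrix R).mulVecLin := by
    refine Submodule.eq_of_le_of_finrank_le ?_ (by lia)
    rintro _ ⟨x, rfl⟩
    exact faceMatrix_mulVec_vertexCoboundary R x
  obtain ⟨x, hx⟩ : (1 : G.edgeSet → ZMod 2) ∈ LinearMap.range (vertexCoboundary G) :=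
    hexact ▸ faceMatrix_mulVec_one R hR
  refine ⟨Coloring.mk (α := Fin 2) x fun {u v} huv huv' => ?_⟩
  have h1 := congrFun hx (dartEdge ⟨(u, v), huv⟩)
  rw [vertexCoboundary_dartEdge] at h1
  have h2 : x u = x v := huv'
  rw [h2, CharTwo.add_self_eq_zero] at h1
  exact zero_ne_one h1

end Bipartite

/-! ### Perfect matchings after deleting few edges of a regular bipartite graph -/

section Matching

variable {V : Type*} [Fintype V] {G : SimpleGraph V} [DecidableRel G.Adj]

/-- Hall's condition, in the graph `H` that remains when at most `k` edges are deleted, for a subset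
`A` of one colour class. -/
lemma card_le_card_neighbors_deleteEdges [DecidableEq V] {p q : Finset V} {k : ℕ} (hk : 0 < k)
    (hG : G.IsRegularOfDegree k) (hpq : G.IsBipartiteWith p q) {S : Finset (Sym2 V)}
    {H : SimpleGraph V} [DecidableRel H.Adj] (hH : H = G.deleteEdges (S : Set (Sym2 V)))
    (hS : #S ≤ k) (hconn : H.Connected) {A : Finset V} (hA : A ⊆ p) :
    #A ≤ #{w | ∃ v ∈ A, H.Adj v w} := by
  have hadj : ∀ {u v}, H.Adj u v ↔ G.Adj u v ∧ s(u, v) ∉ S := by simp [hH]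
  have hHG : ∀ {u v}, H.Adj u v → G.Adj u v := fun h => (hadj.1 h).1
  set N : Finset V := {w | ∃ v ∈ A, H.Adj v w} with hN
  have hdisj : ∀ v, v ∈ p → v ∉ q := fun v hp hq => Set.disjoint_left.1 hpq.disjoint hp hq
  by_contra! hlt
  -- The deleted edges at `A`, each of which has exactly one end in `A`.
  have hdel : ∑ v ∈ A, #{w | G.Adj v w ∧ s(v, w) ∈ S} ≤ #S := by
    rw [← card_sigma]
    refine card_le_card_of_injOn (fun x => s(x.1, x.2)) (fun x hx => ?_) ?_
    · simp only [coe_sigma, Set.mem_sigma_iff, mem_coe, mem_filter] at hx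
      exact hx.2.2.2
    · rintro ⟨v, w⟩ hx ⟨v', w'⟩ hx' h
      simp only [coe_sigma, Set.mem_sigma_iff, mem_coe, mem_filter] at hx hx'
      have hw : w ∈ q := hpq.mem_of_mem_adj (hA hx.1) hx.2.2.1
      rcases Sym2.eq_iff.1 h with ⟨rfl, rfl⟩ | ⟨rfl, rfl⟩
      · rfl
      · exact absurd hw (hdisj _ (hA hx'.1))
  have hsplit : ∀ v, k = #{w | H.Adj v w} + #{w | G.Adj v w ∧ s(v, w) ∈ S} := by
    intro v
    have hunion : G.neighborFinset v
        = ({w | H.Adj v w} : Finset V) ∪ ({w | G.Adj v w ∧ s(v, w) ∈ S} : Finset V) := by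
      ext w
      simp only [mem_neighborFinset, mem_union, mem_filter, mem_univ, true_and, hadj]
      tauto
    rw [← hG.degree_eq v, ← card_neighborFinset_eq_degree, hunion, card_union_of_disjoint]
    refine disjoint_left.2 fun w hw hw' => ?_
    simp only [mem_filter, mem_univ, true_and, hadj] at hw hw'
    exact hw.2 hw'.2
  have hdouble : ∑ v ∈ A, #{w | H.Adj v w} = ∑ w ∈ N, #{v ∈ A | H.Adj v w} := by
    refine Eq.trans ?_ (sum_card_bipartiteAbove_eq_sum_card_bipartiteBelow (s := A) (t := N) H.Adj)
    refine sum_congr rfl fun v hv => ?_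
    congr 1
    ext w
    simp only [bipartiteAbove, hN, mem_filter, mem_univ, true_and]
    exact ⟨fun h => ⟨⟨v, hv, h⟩, h⟩, fun h => h.2⟩
  have hcount : k * #A = ∑ w ∈ N, #{v ∈ A | H.Adj v w}
      + ∑ v ∈ A, #{w | G.Adj v w ∧ s(v, w) ∈ S} := by
    rw [← hdouble, ← sum_add_distrib, ← sum_congr rfl (fun v _ => hsplit v), sum_const,
      smul_eq_mul, mul_comm]
  have hle : ∀ w ∈ N, #{v ∈ A | H.Adj v w} ≤ k := fun w _ => by
    rw [← hG.degree_eq w, ← card_neighborFinset_eq_degree]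
    exact card_le_card fun v hv => by
      simpa using (hHG (mem_filter.1 hv).2).symm
  have hmul : k * (#N + 1) ≤ k * #A := Nat.mul_le_mul_left k hlt
  -- Equality in the count leaves no edge from `N` to a vertex outside `A`.
  have hback : ∀ w ∈ N, ∀ v, H.Adj w v → v ∈ A := by
    intro w hw v hwv
    by_contra hv
    have hwlt : #{v ∈ A | H.Adj v w} < k := by
      rw [← hG.degree_eq w, ← card_neighborFinset_eq_degree]
      refine card_lt_card ((ssubset_iff_of_subset fun u hu => ?_).2 ⟨v, ?_, ?_⟩)
      · simpa using (hHG (mem_filter.1 hu).2).symm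
      · simpa using hHG hwv
      · simp [hv]
    have := sum_lt_sum hle ⟨w, hw, hwlt⟩
    rw [sum_const, smul_eq_mul, mul_comm] at this
    lia
  obtain ⟨a, ha⟩ : A.Nonempty := card_pos.1 (by lia)
  have hall : ∀ v, v ∈ A ∨ v ∈ N := by
    refine forall_of_connected hconn (P := fun v => v ∈ A ∨ v ∈ N) (Or.inl ha) ?_
    rintro u v huv (hu | hu)
    · exact Or.inr (mem_filter.2 ⟨mem_univ _, u, hu, huv⟩)
    · exact Or.inl (hback u hu v huv)
  have hqN : q ⊆ N := fun v hv => (hall v).resolve_left fun h => hdisj v (hA h) hv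
  have hbal := isBipartiteWith_sum_degrees_eq hpq
  simp only [hG.degree_eq, sum_const, smul_eq_mul] at hbal
  have := Nat.eq_of_mul_eq_mul_right hk hbal
  have := card_le_card hqN
  have := card_le_card hA
  lia

/-- If at most `k` edges of a `k`-regular bipartite graph are deleted and the rest is connected,
then the rest has a perfect matching. -/
theorem exists_isPerfectMatching_deleteEdges {k : ℕ} (hk : 0 < k) (hG : G.IsRegularOfDegree k)
    (hbip : G.IsBipartite) {S : Set (Sym2 V)} (hS : S.encard ≤ k)
    (hconn : (G.deleteEdges S).Connected) :
    ∃ M : (G.deleteEdges S).Subgraph, M.IsPerfectMatching := by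
  classical
  obtain ⟨p, q, hpq⟩ := hbip.exists_isBipartiteWith
  obtain ⟨p, rfl⟩ := p.toFinite.exists_finset_coe
  obtain ⟨q, rfl⟩ := q.toFinite.exists_finset_coe
  obtain ⟨S, rfl⟩ := S.toFinite.exists_finset_coe
  replace hS : #S ≤ k := by simpa [Set.encard_coe_eq_coe_finsetCard] using hS
  have hpqH : (G.deleteEdges (S : Set (Sym2 V))).IsBipartiteWith p q :=
    ⟨hpq.disjoint, fun _ _ h => hpq.mem_of_adj (deleteEdges_adj.1 h).1⟩
  refine exists_isPerfectMatching_of_forall_ncard_le hpqH fun s => ?_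
  obtain ⟨s, rfl⟩ := s.toFinite.exists_finset_coe
  set H := G.deleteEdges (S : Set (Sym2 V)) with hH
  -- Regularity with `k > 0` puts every vertex in one of the two classes.
  have hcover : ∀ v, v ∈ p ∨ v ∈ q := fun v => by
    have hpos : 0 < #(G.neighborFinset v) := by
      rwa [card_neighborFinset_eq_degree, hG.degree_eq]
    obtain ⟨w, hw⟩ := card_pos.1 hpos
    rcases hpq.mem_of_adj ((mem_neighborFinset _ _ _).1 hw) with h | h
    · exact Or.inl h.1
    · exact Or.inr h.1
  have h1 := card_le_card_neighbors_deleteEdges hk hG hpq rfl hS hconn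
    (A := s ∩ p) inter_subset_right
  have h2 := card_le_card_neighbors_deleteEdges hk hG hpq.symm rfl hS hconn
    (A := s ∩ q) inter_subset_right
  have hs : s ⊆ (s ∩ p) ∪ (s ∩ q) := fun v hv => by
    rcases hcover v with h | h <;> simp [hv, h]
  have hdisj : Disjoint ({w | ∃ v ∈ s ∩ p, H.Adj v w} : Finset V)
      ({w | ∃ v ∈ s ∩ q, H.Adj v w} : Finset V) := by
    refine disjoint_left.2 fun w hw hw' => ?_
    obtain ⟨v, hv, hvw⟩ := (mem_filter.1 hw).2
    obtain ⟨v', hv', hvw'⟩ := (mem_filter.1 hw').2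
    exact Set.disjoint_left.1 hpq.disjoint
      (hpqH.symm.mem_of_mem_adj (mem_inter.1 hv').2 hvw')
      (hpqH.mem_of_mem_adj (mem_inter.1 hv).2 hvw)
  have hN : (⋃ x ∈ (s : Set V), H.neighborSet x)
      ⊇ ((({w | ∃ v ∈ s ∩ p, H.Adj v w} : Finset V) ∪ ({w | ∃ v ∈ s ∩ q, H.Adj v w} : Finset V) :
        Finset V) : Set V) := by
    intro w hw
    simp only [coe_union, Set.mem_union, mem_coe, mem_filter, mem_univ, true_and, mem_inter] at hw
    simp only [Set.mem_iUnion, mem_neighborSet, mem_coe]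
    rcases hw with ⟨v, hv, h⟩ | ⟨v, hv, h⟩ <;> exact ⟨v, hv.1, h⟩
  calc (s : Set V).ncard = #s := Set.ncard_coe_finset s
    _ ≤ #(s ∩ p) + #(s ∩ q) := (card_le_card hs).trans (card_union_le _ _)
    _ ≤ _ := Nat.add_le_add h1 h2
    _ = _ := (card_union_of_disjoint hdisj).symm
    _ = _ := (Set.ncard_coe_finset _).symm
    _ ≤ _ := Set.ncard_le_ncard hN (Set.toFinite _)

end Matching

/-! ### An anti-Kekulé set with four edges -/

section UpperBound

variable {V : Type*} {G : SimpleGraph V}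

/-- The edges at two neighbours of a vertex `b` that do not contain `b` form an anti-Kekulé set:
once they are deleted, a perfect matching would have to match `b` with both neighbours. -/
lemma isAntiKekuleSet_of_adj (hG : IsVertexConnected G 3) {b w₁ w₂ : V} (h₁ : G.Adj b w₁)
    (h₂ : G.Adj b w₂) (hne : w₁ ≠ w₂) :
    IsAntiKekuleSet G {e ∈ G.edgeSet | (w₁ ∈ e ∨ w₂ ∈ e) ∧ b ∉ e} := by
  set S : Set (Sym2 V) := {e ∈ G.edgeSet | (w₁ ∈ e ∨ w₂ ∈ e) ∧ b ∉ e} with hS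
  have hbS : ∀ {w}, G.Adj b w → (G.deleteEdges S).Adj b w := fun h =>
    deleteEdges_adj.2 ⟨h, fun hm => hm.2.2 (Sym2.mem_mk_left _ _)⟩
  refine ⟨fun e he => he.1, ?_, ?_⟩
  · have hcard : ({w₁, w₂} : Set V).ncard < 3 := by
      rw [Set.ncard_pair hne]
      norm_num
    have hconn := hG.2 {w₁, w₂} hcard
    let φ : G.induce ({w₁, w₂} : Set V)ᶜ →g G.deleteEdges S :=
      { toFun := Subtype.val
        map_rel' := by
          rintro ⟨u, hu⟩ ⟨v, hv⟩ huv
          refine deleteEdges_adj.2 ⟨huv, fun hm => ?_⟩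
          simp only [Set.mem_compl_iff, Set.mem_insert_iff, Set.mem_singleton_iff, not_or] at hu hv
          rcases hm.2.1 with h | h <;> rcases Sym2.mem_iff.1 h with h | h <;>
            simp_all }
    have hb : b ∈ ({w₁, w₂} : Set V)ᶜ := by simp [h₁.ne, h₂.ne]
    have hreach : ∀ v, (G.deleteEdges S).Reachable b v := by
      intro v
      by_cases hv : v ∈ ({w₁, w₂} : Set V)ᶜ
      · exact (hconn.preconnected ⟨b, hb⟩ ⟨v, hv⟩).map φ
      · rw [Set.notMem_compl_iff] at hv
        rcases hv with rfl | rfl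
        · exact (hbS h₁).reachable
        · exact (hbS h₂).reachable
    exact (connected_iff _).2 ⟨fun u v => (hreach u).symm.trans (hreach v), ⟨b⟩⟩
  · rintro ⟨M, hM⟩
    have hpend : ∀ w, G.Adj b w → (w = w₁ ∨ w = w₂) → M.Adj b w := by
      intro w hbw hw
      obtain ⟨x, hx, -⟩ := Subgraph.isPerfectMatching_iff.1 hM w
      have hadj := deleteEdges_adj.1 hx.adj_sub
      have hbx : b ∈ s(w, x) := by
        by_contra hb
        refine hadj.2 ⟨hadj.1, ?_, hb⟩
        rcases hw with rfl | rfl <;> simp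
      rcases Sym2.mem_iff.1 hbx with h | h
      · exact absurd h hbw.ne
      · exact h ▸ hx.symm
    exact hne ((Subgraph.isPerfectMatching_iff.1 hM b).unique
      (hpend w₁ h₁ (Or.inl rfl)) (hpend w₂ h₂ (Or.inr rfl)))

/-- A 3-connected cubic graph has an anti-Kekulé set with at most four edges. -/
theorem exists_isAntiKekuleSet_encard_le_four [Fintype V] [DecidableRel G.Adj]
    (hG : IsVertexConnected G 3) (hcubic : G.IsRegularOfDegree 3) :
    ∃ S, IsAntiKekuleSet G S ∧ S.encard ≤ 4 := by
  classical
  obtain ⟨b⟩ : Nonempty V := (Nat.card_pos_iff.1 (by have := hG.1; lia)).1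
  obtain ⟨w₁, hw₁, w₂, hw₂, hne⟩ : ∃ w₁ ∈ G.neighborFinset b, ∃ w₂ ∈ G.neighborFinset b,
      w₁ ≠ w₂ := one_lt_card.1 (by rw [card_neighborFinset_eq_degree, hcubic.degree_eq]; norm_num)
  rw [mem_neighborFinset] at hw₁ hw₂
  refine ⟨_, isAntiKekuleSet_of_adj hG hw₁ hw₂ hne, ?_⟩
  set T : V → Finset (Sym2 V) := fun w => ((G.neighborFinset w).erase b).image fun x => s(w, x)
  have hT : ∀ w, G.Adj b w → #(T w) ≤ 2 := fun w hw => by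
    refine card_image_le.trans ?_
    rw [card_erase_of_mem (by simpa using hw.symm), card_neighborFinset_eq_degree,
      hcubic.degree_eq]
  have hmem : ∀ w, ∀ e ∈ G.edgeSet, w ∈ e → b ∉ e → e ∈ T w := by
    intro w e he hw hb
    obtain ⟨x, rfl⟩ := hw
    refine mem_image.2 ⟨x, mem_erase.2 ⟨?_, by simpa using he⟩, rfl⟩
    rintro rfl
    exact hb (Sym2.mem_mk_right _ _)
  have hsub : {e ∈ G.edgeSet | (w₁ ∈ e ∨ w₂ ∈ e) ∧ b ∉ e} ⊆ ((T w₁ ∪ T w₂ : Finset _) : Set _) := by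
    rintro e ⟨he, h | h, hb⟩
    · exact mem_coe.2 (mem_union_left _ (hmem _ e he h hb))
    · exact mem_coe.2 (mem_union_right _ (hmem _ e he h hb))
  refine (Set.encard_le_encard hsub).trans ?_
  rw [Set.encard_coe_eq_coe_finsetCard]
  have : #(T w₁ ∪ T w₂) ≤ 4 := (card_union_le _ _).trans (Nat.add_le_add (hT _ hw₁) (hT _ hw₂))
  exact_mod_cast this

end UpperBound

/-! ### The anti-Kekulé number -/

lemma IsVertexConnected.connected {V : Type*} {G : SimpleGraph V} {k : ℕ} (hk : 0 < k)
    (hG : IsVertexConnected G k) : G.Connected := by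
  have h := hG.2 ∅ (by simpa using hk)
  rw [Set.compl_empty] at h
  exact (induceUnivIso G).connected_iff.1 h

end AntiKekule

open AntiKekule in
theorem mainTheorem5 {V : Type*} [Fintype V] (G : SimpleGraph V) [DecidableRel G.Adj]
    (hG : AntiKekule.IsFullerene46 G) :
    AntiKekule.antiKekuleNumber G = 4 := by
  refine le_antisymm ?_ (le_iInf₂ fun S hS => ?_)
  · obtain ⟨S, hS, hcard⟩ := exists_isAntiKekuleSet_encard_le_four hG.connected hG.cubic
    exact (iInf₂_le S hS).trans hcard
  · by_contra! hlt
    obtain ⟨R, hplanar, hface⟩ := hG.planar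
    have heven : ∀ f : R.Face, Even f.length := fun f => by
      rcases hface f with h | h <;> rw [h] <;> decide
    have hbip := isBipartite_of_isPlanar_of_even_length R
      (hG.connected.connected (by norm_num)) hplanar heven
    exact hS.2.2 (exists_isPerfectMatching_deleteEdges (by norm_num) hG.cubic hbip
      (ENat.lt_add_one_iff (by simp) |>.1 (by norm_num; exact hlt)) hS.2.1)
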